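/- Let $d\ge 0$ be an integer and let $\Gamma$ be a finite simple graph with vertex set $V$, $|V|\ge d+1$. Suppose $\Gamma$ is $(d+1)$-connected, i.e. deleting any set of at most $d$ vertices from $\Gamma$ leaves a (nonempty) connected graph. Let $\Gamma^2$ be the squared graph of $\Gamma$: it has vertex set $V$, and two distinct vertices are adjacent in $\Gamma^2$ if they are adjacent in $\Gamma$ or have a common neighbor in $\Gamma$. Let $p\colon V\to\mathbb R^d$ be generic, i.e. its $d|V|$ coordinates satisfy no nonzero polynomial equation with rational coefficients. Then the framework $(p,\Gamma^2)$ is universally (Euclideanly) rigid. That is, for every $d'\ge d$, regarding $\mathbb R^d$ as the first $d$ coordinates of $\mathbb R^{d'}$, the following holds: if $q\colon V\to\mathbb R^{d'}$ is such that for every edge $\{u,v\}$ of $\Gamma^2$ there is a Euclidean isometry $g_{uv}$ of $\mathbb R^{d'}$ with $g_{uv}(p(u))=q(u)$ and $g_{uv}(p(v))=q(v)$, then there is a single Euclidean isometry $g$ of $\mathbb R^{d'}$ with $g(p(u))=q(u)$ for all $u\in V$. -/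

import Mathlib

namespace GraphFramework

/-- The squared graph: distinct vertices are adjacent if they are adjacent in `G`
or share a neighbour in `G`. -/
def squaredGraph {V : Type*} (G : SimpleGraph V) : SimpleGraph V where
  Adj i j := i ≠ j ∧ (G.Adj i j ∨ ∃ k, G.Adj i k ∧ G.Adj j k)
  symm := ⟨fun _ _ h =>
    ⟨h.1.symm, h.2.imp (fun e => e.symm) (fun ⟨k, h₁, h₂⟩ => ⟨k, h₂, h₁⟩)⟩⟩
  loopless := ⟨fun _ h => h.1 rfl⟩

/-- `k`-vertex-connectedness: deleting any set of fewer than `k` vertices leaves a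
(nonempty) connected graph. The complete graph on exactly `k` vertices is included. -/
def IsVertexConnected {V : Type*} (G : SimpleGraph V) (k : ℕ) : Prop :=
  ∀ S : Finset V, S.card < k → (G.induce {v : V | v ∉ S}).Connected

/-- Configurations of the vertex set `V` in `ℝ^d`. -/
abbrev Configuration (V : Type*) (d : ℕ) : Type _ := V → EuclideanSpace ℝ (Fin d)

/-- A configuration is generic if its coordinates, jointly, satisfy no nonzero polynomial
equation with rational coefficients. -/
def IsGeneric {V : Type*} {d : ℕ} (p : Configuration V d) : Prop :=
  AlgebraicIndependent ℚ (fun x : V × Fin d => p x.1 x.2)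

/-- Frameworks `(p, G)` and `(q, G)` are Euclidean equivalent if for each edge some isometry
of `ℝ^d`, depending on the edge, maps its ends under `p` to its ends under `q`. -/
def EuclideanEquivalent {V : Type*} (G : SimpleGraph V) {d : ℕ} (p q : Configuration V d) :
    Prop :=
  ∀ u v : V, G.Adj u v →
    ∃ g : EuclideanSpace ℝ (Fin d) ≃ᵢ EuclideanSpace ℝ (Fin d), g (p u) = q u ∧ g (p v) = q v

/-- Configurations are Euclidean congruent if a single isometry of `ℝ^d` maps one to the
other. -/
def EuclideanCongruent {V : Type*} {d : ℕ} (p q : Configuration V d) : Prop :=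
  ∃ g : EuclideanSpace ℝ (Fin d) ≃ᵢ EuclideanSpace ℝ (Fin d), ∀ u : V, g (p u) = q u

/-- Global Euclidean rigidity of the framework `(p, G)` in `ℝ^d`. -/
def IsGloballyRigid {V : Type*} (G : SimpleGraph V) {d : ℕ} (p : Configuration V d) : Prop :=
  ∀ q : Configuration V d, EuclideanEquivalent G p q → EuclideanCongruent p q

/-- The configuration in `ℝ^d'` obtained by including `ℝ^d` as the first `d` coordinates
(used for `d ≤ d'`). -/
def includeConfiguration {V : Type*} {d : ℕ} (d' : ℕ) (p : Configuration V d) :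
    Configuration V d' :=
  fun u => WithLp.toLp 2 (fun i : Fin d' => if h : (i : ℕ) < d then p u ⟨i, h⟩ else 0)

/-- Universal (global) Euclidean rigidity: `(p, G)` is globally rigid when regarded as a
framework in `ℝ^d'`, for every `d' ≥ d`. -/
def IsUniversallyRigid {V : Type*} (G : SimpleGraph V) {d : ℕ} (p : Configuration V d) : Prop :=
  ∀ d' : ℕ, d ≤ d' → IsGloballyRigid G (includeConfiguration d' p)

end GraphFramework

/-!
Each closed neighbourhood `N[v]` of `G` is a clique of the squared graph. An equivalent
configuration `q` therefore has the same mutual distances as `p` on each `N[v]`, and in particular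
every affine dependency among the points `p u`, `u ∈ N[v]`, is a dependency among the points `q u`
(`localDet_eq_zero_of_dist_eq`). The heart of the proof is that this forces `q` to be the image of
`p` under a single affine map (`IsVertexConnected.exists_affine`). Since some `N[v]` contains
`d + 1` affinely independent points with the correct mutual distances, this map preserves all
distances, and configurations with the same distances are congruent
(`euclideanCongruent_of_dist_eq`).

Affine rigidity says that, for a fixed set `S` of `d + 1` vertices, a function which vanishes on `S`
and satisfies all local affine dependencies of `p` is zero. The local dependencies of `d + 2`
points are given by determinants polynomial in the coordinates of `p`, so by taking a Gram
determinant it suffices to find one configuration, in general position, for which the assertion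
holds (`eq_zero_of_localDet_of_algebraicIndependent`).

Such a configuration is obtained by reversing the roles of points and dependencies
(`IsVertexConnected.exists_configuration`). Take a generic matrix `W` with one row for each vertex
`v ∉ S`, supported on `N[v]`. Removing the columns of any `(d + 1)`-set `U` leaves a square matrix,
which is nonsingular if the complements of `S` and `U` are matched along closed neighbourhoods. By
Hall's theorem such a matching exists: for `A` nonempty and disjoint from `S`, either `N[A]` is
everything, or `N[A] \ A` separates `A` from the remaining vertices and so has at least `d + 1`
elements; in both cases `N[A] \ U` has at least as many elements as `A`. The kernel of `W` thus has
dimension `d + 1` and restricts isomorphically to every `(d + 1)`-set. Dividing by an element of the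
kernel without zeros, a basis of the kernel consisting of the constant `1` and `d` further functions
gives the coordinates of the required configuration.
-/

namespace GraphFramework

/-! ### Closed neighbourhoods and matchings -/

/-- The closed neighbourhood of `v`: the vertex `v` together with its neighbours. -/
def closedNbhd {V : Type*} (G : SimpleGraph V) (v : V) : Set V :=
  {u | u = v ∨ G.Adj v u}

/-- A closed neighbourhood in `G` is a clique of the squared graph. -/
theorem squaredGraph_adj_of_mem_closedNbhd {V : Type*} {G : SimpleGraph V} {v a b : V}
    (ha : a ∈ closedNbhd G v) (hb : b ∈ closedNbhd G v) (hab : a ≠ b) :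
    (squaredGraph G).Adj a b := by
  refine ⟨hab, ?_⟩
  rcases ha with rfl | ha <;> rcases hb with rfl | hb
  · exact absurd rfl hab
  · exact Or.inl hb
  · exact Or.inl ha.symm
  · exact Or.inr ⟨v, ha.symm, hb.symm⟩

open Classical in
/-- In a `k`-connected graph, a nonempty set `A` whose closed neighbourhood is not everything
has at least `k` neighbours outside `A`, since these neighbours separate `A` from the rest. -/
theorem IsVertexConnected.add_card_le_card_biUnion_closedNbhd {V : Type*} [Fintype V]
    {G : SimpleGraph V} {k : ℕ} (hG : IsVertexConnected G k) {A : Finset V} (hA : A.Nonempty)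
    (hN : (Finset.univ.filter fun u => ∃ a ∈ A, u ∈ closedNbhd G a) ≠ Finset.univ) :
    k + A.card ≤ (Finset.univ.filter fun u => ∃ a ∈ A, u ∈ closedNbhd G a).card := by
  set N : Finset V := Finset.univ.filter fun u => ∃ a ∈ A, u ∈ closedNbhd G a with hNdef
  have hAN : A ⊆ N := fun a ha => by
    simp only [hNdef, Finset.mem_filter_univ]
    exact ⟨a, ha, Or.inl rfl⟩
  by_contra! hlt
  have hcard : (N \ A).card < k := by
    rw [Finset.card_sdiff_of_subset hAN]
    have := Finset.card_le_card hAN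
    omega
  have hconn := hG (N \ A) hcard
  obtain ⟨a, ha⟩ := hA
  obtain ⟨b, hb⟩ : ∃ b, b ∉ N := by
    by_contra! h
    exact hN (Finset.eq_univ_of_forall h)
  have key : ∀ x y : {v : V | v ∉ N \ A}, (G.induce {v : V | v ∉ N \ A}).Walk x y →
      x.1 ∈ A → y.1 ∈ A := by
    intro x y w
    induction w with
    | nil => exact id
    | @cons x y z hxy _ ih =>
      intro hx
      apply ih
      have hyN : y.1 ∈ N := by
        simp only [hNdef, Finset.mem_filter_univ]
        exact ⟨x.1, hx, Or.inr hxy⟩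
      have hy : y.1 ∉ N \ A := y.2
      by_contra hyA
      exact hy (Finset.mem_sdiff.2 ⟨hyN, hyA⟩)
  obtain ⟨w⟩ := hconn.preconnected ⟨a, by simp [ha]⟩ ⟨b, by simp [hb]⟩
  exact hb (hAN (key _ _ w ha))

open Classical in
/-- A closed neighbourhood in a `k`-connected graph on at least `k` vertices has at least `k`
elements. -/
theorem IsVertexConnected.exists_subset_closedNbhd {V : Type*} [Fintype V]
    {G : SimpleGraph V} {k : ℕ} (hG : IsVertexConnected G k) (hcard : k ≤ Fintype.card V)
    (v : V) : ∃ U : Finset V, U.card = k ∧ ∀ u ∈ U, u ∈ closedNbhd G v := by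
  have hk : k ≤ (Finset.univ.filter fun u => ∃ a ∈ ({v} : Finset V), u ∈ closedNbhd G a).card := by
    by_cases h : (Finset.univ.filter fun u => ∃ a ∈ ({v} : Finset V), u ∈ closedNbhd G a)
        = Finset.univ
    · rw [h]
      exact hcard
    · have := hG.add_card_le_card_biUnion_closedNbhd (Finset.singleton_nonempty v) h
      omega
  obtain ⟨U, hU, hUk⟩ := Finset.exists_subset_card_eq hk
  refine ⟨U, hUk, fun u hu => ?_⟩
  simpa using hU hu

open Classical in
/-- By Hall's theorem, the complements of two `k`-sets in a `k`-connected graph are matched along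
closed neighbourhoods. This is the linkage form of Menger's theorem: following the matching leads
from one `k`-set to the other along disjoint paths. -/
theorem IsVertexConnected.exists_matching {V : Type*} [Fintype V]
    {G : SimpleGraph V} {k : ℕ} (hG : IsVertexConnected G k) {S U : Finset V}
    (hS : S.card = k) (hU : U.card = k) :
    ∃ e : {c // c ∉ U} ≃ {v // v ∉ S}, ∀ c, c.1 ∈ closedNbhd G (e c).1 := by
  let t : {v // v ∉ S} → Finset V := fun v =>
    Finset.univ.filter fun c => c ∈ closedNbhd G v.1 ∧ c ∉ U
  have hall : ∀ s : Finset {v // v ∉ S}, s.card ≤ (s.biUnion t).card := by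
    intro s
    rcases s.eq_empty_or_nonempty with rfl | hs
    · simp
    set A : Finset V := s.map (Function.Embedding.subtype _) with hAdef
    have hAcard : A.card = s.card := Finset.card_map _
    have hA : A.Nonempty := by simpa [hAdef] using hs
    have hAS : A.card ≤ Fintype.card V - k := by
      rw [← hS, ← Finset.card_compl]
      refine Finset.card_le_card fun a ha => ?_
      rw [hAdef, Finset.mem_map] at ha
      obtain ⟨x, -, rfl⟩ := ha
      simpa using x.2
    have hunion : s.biUnion t =
        (Finset.univ.filter fun u => ∃ a ∈ A, u ∈ closedNbhd G a) \ U := by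
      ext u
      simp only [t, hAdef, Finset.mem_biUnion, Finset.mem_sdiff, Finset.mem_filter_univ,
        Finset.mem_map, Function.Embedding.subtype_apply]
      constructor
      · rintro ⟨a, ha, h1, h2⟩
        exact ⟨⟨a, ⟨a, ha, rfl⟩, h1⟩, h2⟩
      · rintro ⟨⟨_, ⟨a, ha, rfl⟩, h1⟩, h2⟩
        exact ⟨a, ha, h1, h2⟩
    have hsd := Finset.le_card_sdiff U
      (Finset.univ.filter fun u => ∃ a ∈ A, u ∈ closedNbhd G a)
    rw [hunion, ← hAcard]
    by_cases h : (Finset.univ.filter fun u => ∃ a ∈ A, u ∈ closedNbhd G a) = Finset.univ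
    · rw [h, Finset.card_univ] at hsd
      rw [h]
      omega
    · have := hG.add_card_le_card_biUnion_closedNbhd hA h
      omega
  obtain ⟨f, hf, hft⟩ := (Finset.all_card_le_biUnion_card_iff_exists_injective t).1 hall
  have hft' : ∀ v, f v ∈ closedNbhd G v.1 ∧ f v ∉ U := fun v => by simpa [t] using hft v
  let g : {v // v ∉ S} → {c // c ∉ U} := fun v => ⟨f v, (hft' v).2⟩
  have hg : Function.Bijective g := by
    rw [Fintype.bijective_iff_injective_and_card]
    refine ⟨fun a b h => hf (congrArg Subtype.val h), ?_⟩
    simp [Fintype.card_subtype_compl, hS, hU]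
  refine ⟨(Equiv.ofBijective g hg).symm, fun c => ?_⟩
  obtain ⟨v, rfl⟩ := (Equiv.ofBijective g hg).surjective c
  rw [Equiv.symm_apply_apply]
  exact (hft' v).1

/-! ### Homogeneous coordinates and local determinants -/

/-- The homogeneous coordinates `(1, x v)` of the point `x v`, over any ring. -/
def homogeneousCoord {V R : Type*} [One R] {d : ℕ} (x : V → Fin d → R) (v : V) :
    Fin (d + 1) → R :=
  Fin.cons 1 (x v)

@[simp]
theorem homogeneousCoord_zero {V R : Type*} [One R] {d : ℕ} (x : V → Fin d → R) (v : V) :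
    homogeneousCoord x v 0 = 1 := rfl

@[simp]
theorem homogeneousCoord_succ {V R : Type*} [One R] {d : ℕ} (x : V → Fin d → R) (v : V)
    (i : Fin d) : homogeneousCoord x v i.succ = x v i := rfl

theorem map_homogeneousCoord {V R R' : Type*} [CommRing R] [CommRing R'] {d : ℕ} (φ : R →+* R')
    (x : V → Fin d → R) (v : V) (j : Fin (d + 1)) :
    φ (homogeneousCoord x v j) = homogeneousCoord (fun v i => φ (x v i)) v j := by
  refine Fin.cases ?_ (fun i => ?_) j <;> simp

/-- The determinant of the `d + 1` points `x (s i)` in homogeneous coordinates. It is nonzero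
exactly when the points are affinely independent. -/
def simplexDet {V R : Type*} [CommRing R] {d : ℕ} (x : V → Fin d → R) (s : Fin (d + 1) → V) : R :=
  (Matrix.of fun i j => homogeneousCoord x (s i) j).det

theorem map_simplexDet {V R R' : Type*} [CommRing R] [CommRing R'] {d : ℕ} (φ : R →+* R')
    (x : V → Fin d → R) (s : Fin (d + 1) → V) :
    φ (simplexDet x s) = simplexDet (fun v i => φ (x v i)) s := by
  rw [simplexDet, RingHom.map_det, simplexDet]
  congr 1
  ext i j
  simp [map_homogeneousCoord]

/-- For `d + 2` vertices `t`, the determinant whose rows are the homogeneous coordinates of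
`x (t i)` followed by the value `f (t i)`. It vanishes when `f ∘ t` is an affine function of
`x ∘ t`. It is defined through `Matrix.cramer` to make it linear in `f`. -/
noncomputable def localDet {V R : Type*} [CommRing R] {d : ℕ} (x : V → Fin d → R)
    (t : Option (Fin (d + 1)) → V) : (V → R) →ₗ[R] R :=
  LinearMap.proj none ∘ₗ
    Matrix.cramer (Matrix.of fun i j => j.elim 0 (homogeneousCoord x (t i))) ∘ₗ
      LinearMap.funLeft R R t

theorem localDet_eq_det {V R : Type*} [CommRing R] {d : ℕ} (x : V → Fin d → R)
    (t : Option (Fin (d + 1)) → V) (f : V → R) :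
    localDet x t f =
      (Matrix.of fun i j => Option.elim j (f (t i)) (homogeneousCoord x (t i))).det := by
  simp only [localDet, LinearMap.comp_apply, LinearMap.proj_apply, Matrix.cramer_apply]
  congr 1
  ext i j
  cases j <;> simp [LinearMap.funLeft_apply]

theorem map_localDet {V R R' : Type*} [CommRing R] [CommRing R'] {d : ℕ} (φ : R →+* R')
    (x : V → Fin d → R) (t : Option (Fin (d + 1)) → V) (f : V → R) :
    φ (localDet x t f) = localDet (fun v i => φ (x v i)) t (fun v => φ (f v)) := by
  rw [localDet_eq_det, RingHom.map_det, localDet_eq_det]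
  congr 1
  ext i j
  cases j <;> simp [map_homogeneousCoord]

theorem localDet_homogeneousCoord_sum {V : Type*} {d : ℕ} (x : V → Fin d → ℝ)
    (t : Option (Fin (d + 1)) → V) (a : Fin (d + 1) → ℝ) :
    localDet x t (fun v => ∑ j, homogeneousCoord x v j * a j) = 0 := by
  rw [localDet_eq_det, ← Matrix.exists_mulVec_eq_zero_iff]
  refine ⟨fun j => Option.elim j (-1) a, fun h => ?_, ?_⟩
  · simpa using congrFun h none
  · ext i
    simp [Matrix.mulVec, dotProduct, Fintype.sum_option]

theorem eq_zero_of_simplexDet_ne_zero {V : Type*} {d : ℕ} {x : V → Fin d → ℝ}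
    {s : Fin (d + 1) → V} (hs : simplexDet x s ≠ 0) {b : Fin (d + 1) → ℝ}
    (hb : ∀ i, ∑ j, homogeneousCoord x (s i) j * b j = 0) : b = 0 :=
  Matrix.eq_zero_of_mulVec_eq_zero hs (funext hb)

/-- A function is interpolated at the vertices of a simplex by an affine function. -/
theorem exists_interpolation {V : Type*} {d : ℕ} {x : V → Fin d → ℝ}
    {s : Fin (d + 1) → V} (hs : simplexDet x s ≠ 0) (f : V → ℝ) :
    ∃ a : Fin (d + 1) → ℝ, ∀ i, f (s i) = ∑ j, homogeneousCoord x (s i) j * a j := by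
  have hu : IsUnit (Matrix.of fun i j => homogeneousCoord x (s i) j) :=
    (Matrix.isUnit_iff_isUnit_det _).2 (isUnit_iff_ne_zero.2 hs)
  obtain ⟨a, ha⟩ := (Matrix.mulVec_surjective_iff_isUnit.2 hu) (fun i => f (s i))
  exact ⟨a, fun i => (congrFun ha i).symm⟩

/-- Every point is an affine combination of the vertices of a simplex. -/
theorem exists_barycentric {V : Type*} {d : ℕ} {x : V → Fin d → ℝ}
    {s : Fin (d + 1) → V} (hs : simplexDet x s ≠ 0) (y : Fin (d + 1) → ℝ) :
    ∃ c : Fin (d + 1) → ℝ, ∀ j, y j = ∑ i, c i * homogeneousCoord x (s i) j := by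
  have hu : IsUnit (Matrix.of fun i j => homogeneousCoord x (s i) j) :=
    (Matrix.isUnit_iff_isUnit_det _).2 (isUnit_iff_ne_zero.2 hs)
  obtain ⟨c, hc⟩ := (Matrix.vecMul_surjective_iff_isUnit.2 hu) y
  exact ⟨c, fun j => (congrFun hc j).symm⟩

/-- If all determinants `localDet` built on an affinely independent `s` and one more point of `T`
vanish, then `f` is an affine function of `x` on `T`. -/
theorem exists_affine_of_localDet_eq_zero {V : Type*} {d : ℕ} {x : V → Fin d → ℝ}
    {s : Fin (d + 1) → V} (hs : simplexDet x s ≠ 0) {T : Set V} {f : V → ℝ}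
    (hf : ∀ u ∈ T, localDet x (fun i => Option.elim i u s) f = 0) :
    ∃ a : Fin (d + 1) → ℝ, ∀ u ∈ T, f u = ∑ j, homogeneousCoord x u j * a j := by
  obtain ⟨a, ha⟩ := exists_interpolation hs f
  refine ⟨a, fun u hu => ?_⟩
  -- Subtracting the interpolating function, it suffices to treat `g` vanishing on the simplex.
  set g : V → ℝ := f - fun v => ∑ j, homogeneousCoord x v j * a j with hg
  have hgs : ∀ i, g (s i) = 0 := fun i => by simp [hg, ha i]
  have h0 : localDet x (fun i => Option.elim i u s) g = 0 := by
    rw [hg, map_sub, hf u hu, localDet_homogeneousCoord_sum, sub_zero]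
  rw [localDet_eq_det, ← Matrix.exists_mulVec_eq_zero_iff] at h0
  obtain ⟨y, hy0, hy⟩ := h0
  have hb : (fun j => y (some j)) = 0 := by
    apply eq_zero_of_simplexDet_ne_zero hs
    intro i
    simpa [Matrix.mulVec, dotProduct, Fintype.sum_option, hgs i] using congrFun hy (some i)
  have hb' : ∀ j, y (some j) = 0 := congrFun hb
  have hyn : y none ≠ 0 := fun h => hy0 (funext fun j => by cases j <;> simp [h, hb'])
  have := congrFun hy none
  simp only [Matrix.mulVec, dotProduct, Fintype.sum_option, Matrix.of_apply, Option.elim,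
    hb', mul_zero, Finset.sum_const_zero, add_zero, Pi.zero_apply, mul_eq_zero, hyn,
    or_false] at this
  exact sub_eq_zero.1 this

/-! ### A special configuration with a stress of maximal rank -/

open Classical in
/-- A generic matrix `W` whose rows are supported on closed neighbourhoods. For each `k`-set `U`,
the matching of `IsVertexConnected.exists_matching` is a nonzero term in the determinant of the
square block of `W` with rows outside `S` and columns outside `U`. -/
theorem IsVertexConnected.exists_weights {V : Type*} [Fintype V] {G : SimpleGraph V} {k : ℕ}
    (hG : IsVertexConnected G k) {S : Finset V} (hS : S.card = k) :
    ∃ W : V → V → ℝ, (∀ v c, c ∉ closedNbhd G v → W v c = 0) ∧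
      ∀ U : Finset V, U.card = k → ∀ f : V → ℝ, (∀ u ∈ U, f u = 0) →
        (∀ v ∉ S, ∑ c, W v c * f c = 0) → f = 0 := by
  choose e he using fun U : {U : Finset V // U.card = k} => hG.exists_matching hS U.2
  let M : ∀ U : {U : Finset V // U.card = k},
      Matrix {c // c ∉ U.1} {c // c ∉ U.1} (MvPolynomial (V × V) ℝ) := fun U =>
    Matrix.of fun c c' =>
      if c'.1 ∈ closedNbhd G (e U c).1 then MvPolynomial.X ((e U c).1, c'.1) else 0
  have hM : ∀ U, (M U).det ≠ 0 := by
    intro U h0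
    let w : V × V → ℝ := fun y => if h : y.1 ∉ S then
      (if ((e U).symm ⟨y.1, h⟩).1 = y.2 then 1 else 0) else 0
    have h1 := congrArg (MvPolynomial.eval w) h0
    have hone : (MvPolynomial.eval w).mapMatrix (M U) = 1 := by
      ext c c'
      rw [Matrix.one_apply]
      have hcS : (e U c).1 ∉ S := (e U c).2
      by_cases hcc : c = c'
      · subst hcc
        simp [M, w, he U c, hcS]
      · have : c.1 ≠ c'.1 := fun h => hcc (Subtype.ext h)
        by_cases hn : c'.1 ∈ closedNbhd G (e U c).1 <;> simp [M, w, hn, hcS, hcc, this]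
    rw [RingHom.map_det, hone, Matrix.det_one, map_zero] at h1
    exact one_ne_zero h1
  have hprod : ∏ U, (M U).det ≠ 0 := Finset.prod_ne_zero_iff.2 fun U _ => hM U
  obtain ⟨w, hw⟩ : ∃ w, MvPolynomial.eval w (∏ U, (M U).det) ≠ 0 := by
    by_contra! h
    exact hprod (MvPolynomial.funext fun w => by rw [h w, map_zero])
  rw [map_prod, Finset.prod_ne_zero_iff] at hw
  refine ⟨fun v c => if c ∈ closedNbhd G v then w (v, c) else 0,
    fun v c h => if_neg h, fun U hU f hfU hf => ?_⟩
  have hdet := hw ⟨U, hU⟩ (Finset.mem_univ _)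
  rw [RingHom.map_det] at hdet
  have h0 : (fun c : {c // c ∉ U} => f c.1) = 0 := by
    refine Matrix.eq_zero_of_mulVec_eq_zero hdet (funext fun c => ?_)
    have h2 := hf _ (e ⟨U, hU⟩ c).2
    rw [← Finset.sum_subset (Finset.subset_univ (Finset.univ.filter fun c => c ∉ U))
      (fun x _ hx => by
        have : x ∈ U := by simpa using hx
        simp [hfU x this]),
      Finset.sum_subtype (p := fun c => c ∉ U) _ (fun x => by simp)] at h2
    rw [Pi.zero_apply, ← h2]
    refine Finset.sum_congr rfl fun c' _ => ?_
    by_cases hn : c'.1 ∈ closedNbhd G (e ⟨U, hU⟩ c).1 <;> simp [M, hn]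
  funext c
  by_cases hc : c ∈ U
  · exact hfU c hc
  · exact congrFun h0 ⟨c, hc⟩

open Classical in
/-- If the zero function is the only one in the kernel of the rows outside `S` that vanishes on
`U`, where `S` and `U` have equal size, then this kernel takes arbitrary values on `U`. -/
theorem exists_extension_of_weights {V : Type*} [Fintype V] {S U : Finset V}
    (hSU : S.card = U.card) {W : V → V → ℝ}
    (hW : ∀ f : V → ℝ, (∀ u ∈ U, f u = 0) → (∀ v ∉ S, ∑ c, W v c * f c = 0) → f = 0)
    (g : V → ℝ) : ∃ f : V → ℝ, (∀ u ∈ U, f u = g u) ∧ ∀ v ∉ S, ∑ c, W v c * f c = 0 := by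
  let T : (V → ℝ) →ₗ[ℝ] ({v // v ∉ S} → ℝ) × (U → ℝ) :=
    LinearMap.prod (LinearMap.funLeft ℝ ℝ Subtype.val ∘ₗ (Matrix.of W).mulVecLin)
      (LinearMap.funLeft ℝ ℝ Subtype.val)
  have hTinj : Function.Injective T := by
    rw [injective_iff_map_eq_zero]
    intro f hf
    apply hW f
    · intro u hu
      exact congrFun (congrArg Prod.snd hf) ⟨u, hu⟩
    · intro v hv
      exact congrFun (congrArg Prod.fst hf) ⟨v, hv⟩
  have hrank : Module.finrank ℝ (V → ℝ) =
      Module.finrank ℝ (({v // v ∉ S} → ℝ) × (U → ℝ)) := by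
    have := S.card_le_univ
    simp only [Module.finrank_fintype_fun_eq_card, Module.finrank_prod, Fintype.card_coe,
      Fintype.card_subtype_compl]
    omega
  obtain ⟨f, hf⟩ := (LinearMap.injective_iff_surjective_of_finrank_eq_finrank hrank).1 hTinj
    (0, fun u => g u.1)
  refine ⟨f, fun u hu => congrFun (congrArg Prod.snd hf) ⟨u, hu⟩, fun v hv =>
    congrFun (congrArg Prod.fst hf) ⟨v, hv⟩⟩

open Classical in
/-- There is a configuration `x` in general position with, for each vertex outside a given
`(d + 1)`-set `S`, an affine dependency on its closed neighbourhood, such that a function on the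
vertices vanishing on `S` and annihilated by all these dependencies is zero. It is read off the
kernel of the generic matrix of `IsVertexConnected.exists_weights`, after rescaling by an element
of the kernel without zeros, which puts the constant functions into the kernel. -/
theorem IsVertexConnected.exists_configuration {V : Type*} [Fintype V] {G : SimpleGraph V} {d : ℕ}
    (hG : IsVertexConnected G (d + 1)) {S : Finset V} (hS : S.card = d + 1) :
    ∃ (W : V → V → ℝ) (x : V → Fin d → ℝ), (∀ v c, c ∉ closedNbhd G v → W v c = 0) ∧
      (∀ v ∉ S, ∀ j, ∑ c, W v c * homogeneousCoord x c j = 0) ∧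
      (∀ f : V → ℝ, (∀ u ∈ S, f u = 0) → (∀ v ∉ S, ∑ c, W v c * f c = 0) → f = 0) ∧
      ∀ s : Fin (d + 1) → V, Function.Injective s → simplexDet x s ≠ 0 := by
  obtain ⟨W, hsupp, hW⟩ := hG.exists_weights hS
  have hext := fun (U : Finset V) (hU : U.card = d + 1) =>
    exists_extension_of_weights (hS.trans hU.symm) (hW U hU)
  let H : Submodule ℝ (V → ℝ) := LinearMap.ker
    ((LinearMap.funLeft ℝ ℝ (Subtype.val : {v // v ∉ S} → V)) ∘ₗ (Matrix.of W).mulVecLin)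
  have hH : ∀ f, f ∈ H ↔ ∀ v ∉ S, ∑ c, W v c * f c = 0 := by
    intro f
    rw [LinearMap.mem_ker]
    exact ⟨fun h v hv => congrFun h ⟨v, hv⟩, fun h => funext fun v => h v.1 v.2⟩
  obtain ⟨h, hhH, hh⟩ := Module.Dual.exists_forall_mem_ne_zero_of_forall_exists H
    (fun v : V => (LinearMap.proj v : (V → ℝ) →ₗ[ℝ] ℝ)) (fun v => by
      obtain ⟨U, hvU, hU⟩ := Finset.exists_superset_card_eq (s := {v}) (n := d + 1)
        (by simp) (hS ▸ S.card_le_univ)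
      obtain ⟨f, hf, hfH⟩ := hext U hU 1
      refine ⟨f, (hH f).2 hfH, ?_⟩
      simp [hf v (hvU (Finset.mem_singleton_self v))])
  simp only [LinearMap.proj_apply] at hh
  rw [hH] at hhH
  let e : Fin (d + 1) ≃ S := (S.equivFinOfCardEq hS).symm
  choose F hF hFH using fun i : Fin d =>
    hext S hS (fun v => if v = (e i.succ).1 then h v else 0)
  let x : V → Fin d → ℝ := fun v i => F i v / h v
  have hker : ∀ v ∉ S, ∀ j, ∑ c, W v c * h c * homogeneousCoord x c j = 0 := by
    intro v hv j
    refine Fin.cases ?_ (fun i => ?_) j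
    · simpa using hhH v hv
    · rw [← hFH i v hv]
      refine Finset.sum_congr rfl fun c _ => ?_
      rw [homogeneousCoord_succ, mul_assoc, mul_div_cancel₀ _ (hh c)]
  refine ⟨fun v c => W v c * h c, x, fun v c hc => by simp [hsupp v c hc], hker, ?_, ?_⟩
  · intro f hf hWf
    have : (fun c => h c * f c) = 0 := hW S hS _ (fun u hu => by simp [hf u hu])
      (fun v hv => by simpa [mul_assoc] using hWf v hv)
    funext c
    simpa [hh c] using congrFun this c
  · intro s hs h0
    rw [simplexDet, ← Matrix.exists_mulVec_eq_zero_iff] at h0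
    obtain ⟨b, hb0, hb⟩ := h0
    -- The affine function with coefficients `b` vanishes at the points `s i`, hence everywhere.
    have hz : (fun c => h c * ∑ j, homogeneousCoord x c j * b j) = 0 := by
      refine hW (Finset.univ.image s) (by simp [Finset.card_image_of_injective _ hs]) _ ?_ ?_
      · intro u hu
        obtain ⟨i, -, rfl⟩ := Finset.mem_image.1 hu
        exact mul_eq_zero_of_right _ (congrFun hb i)
      · intro v hv
        simp_rw [← mul_assoc, Finset.mul_sum]
        rw [Finset.sum_comm]
        refine Finset.sum_eq_zero fun j _ => ?_
        simp_rw [← mul_assoc]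
        rw [← Finset.sum_mul, hker v hv j, zero_mul]
    have hz' : ∀ c, ∑ j, homogeneousCoord x c j * b j = 0 := fun c => by
      simpa [hh c] using congrFun hz c
    have hx : ∀ (j : Fin (d + 1)) (i : Fin d), x (e j).1 i = if j = i.succ then 1 else 0 := by
      intro j i
      simp only [x, hF i _ (e j).2]
      by_cases hji : j = i.succ
      · simp [hji, hh]
      · have : (e j).1 ≠ (e i.succ).1 := fun h => hji (e.injective (Subtype.ext h))
        simp [hji, this]
    have hb_zero : b 0 = 0 := by
      have := hz' (e 0).1
      simpa [Fin.sum_univ_succ, hx, (Fin.succ_ne_zero _).symm] using this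
    apply hb0
    funext j
    refine Fin.cases hb_zero (fun i => ?_) j
    simpa [Fin.sum_univ_succ, hx, hb_zero] using hz' (e i.succ).1

/-! ### Transfer to generic configurations -/

theorem aeval_ne_zero_of_algebraicIndependent {σ : Type*} {x y : σ → ℝ}
    (hx : AlgebraicIndependent ℚ x) {P : MvPolynomial σ ℚ} (hP : MvPolynomial.aeval y P ≠ 0) :
    MvPolynomial.aeval x P ≠ 0 := fun h =>
  hP (by rw [hx.eq_zero_of_aeval_eq_zero P h, map_zero])

open scoped Matrix in
theorem det_transpose_mul_self_ne_zero_iff {m n : Type*} [Fintype m] [Fintype n] [DecidableEq n]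
    (A : Matrix m n ℝ) : (Aᵀ * A).det ≠ 0 ↔ ∀ f : n → ℝ, A *ᵥ f = 0 → f = 0 := by
  have hker : ∀ f, (Aᵀ * A) *ᵥ f = 0 ↔ A *ᵥ f = 0 := fun f => by
    exact iff_of_eq (congrArg (f ∈ ·) A.ker_mulVecLin_transpose_mul_self)
  rw [Ne, ← Matrix.exists_mulVec_eq_zero_iff]
  simp only [hker, not_exists, not_and]
  exact forall_congr' fun f => by rw [not_imp_not]

open scoped Matrix in
/-- A polynomial matrix with rational coefficients that is injective at some real point is
injective at every generic point: the Gram determinant is a polynomial that does not vanish. -/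
theorem mulVec_injective_of_algebraicIndependent {m n σ : Type*} [Fintype m] [Fintype n]
    (A : Matrix m n (MvPolynomial σ ℚ)) {x y : σ → ℝ} (hx : AlgebraicIndependent ℚ x)
    (hy : ∀ f : n → ℝ, A.map (MvPolynomial.aeval y) *ᵥ f = 0 → f = 0) :
    ∀ f : n → ℝ, A.map (MvPolynomial.aeval x) *ᵥ f = 0 → f = 0 := by
  classical
  have hdet : ∀ z : σ → ℝ, MvPolynomial.aeval z (Aᵀ * A).det =
      ((A.map (MvPolynomial.aeval z))ᵀ * A.map (MvPolynomial.aeval z)).det := fun z => by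
    rw [AlgHom.map_det, AlgHom.mapMatrix_apply, Matrix.map_mul, Matrix.transpose_map]
  rw [← det_transpose_mul_self_ne_zero_iff, ← hdet] at hy ⊢
  exact aeval_ne_zero_of_algebraicIndependent hx hy

/-- The configuration whose coordinates are the variables of a polynomial ring. -/
noncomputable def universalConfiguration (V : Type*) (d : ℕ) :
    V → Fin d → MvPolynomial (V × Fin d) ℚ :=
  fun v i => MvPolynomial.X (v, i)

theorem aeval_universalConfiguration {V : Type*} {d : ℕ} (x : V → Fin d → ℝ) :
    (fun v i => (MvPolynomial.aeval (fun y : V × Fin d => x y.1 y.2) :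
      MvPolynomial (V × Fin d) ℚ →ₐ[ℚ] ℝ).toRingHom (universalConfiguration V d v i)) = x := by
  funext v i
  simp [universalConfiguration]

theorem simplexDet_ne_zero_of_algebraicIndependent {V : Type*} {d : ℕ} {x y : V → Fin d → ℝ}
    (hx : AlgebraicIndependent ℚ (fun z : V × Fin d => x z.1 z.2)) {s : Fin (d + 1) → V}
    (hy : simplexDet y s ≠ 0) : simplexDet x s ≠ 0 := by
  have h : ∀ z : V → Fin d → ℝ, simplexDet z s = MvPolynomial.aeval
      (fun w : V × Fin d => z w.1 w.2) (simplexDet (universalConfiguration V d) s) := fun z => by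
    conv_lhs => rw [← aeval_universalConfiguration z, ← map_simplexDet]
    rfl
  rw [h] at hy ⊢
  exact aeval_ne_zero_of_algebraicIndependent hx hy

open scoped Matrix in
/-- If at some configuration the only function vanishing on `S`, all of whose local determinants
over a family `𝒯` vanish, is zero, then the same holds at every generic configuration. -/
theorem eq_zero_of_localDet_of_algebraicIndependent {V : Type*} [Fintype V] {d : ℕ}
    {x y : V → Fin d → ℝ}
    (hx : AlgebraicIndependent ℚ (fun z : V × Fin d => x z.1 z.2)) (S : Finset V)
    (𝒯 : Set (Option (Fin (d + 1)) → V))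
    (hy : ∀ f : V → ℝ, (∀ u ∈ S, f u = 0) → (∀ t ∈ 𝒯, localDet y t f = 0) → f = 0) :
    ∀ f : V → ℝ, (∀ u ∈ S, f u = 0) → (∀ t ∈ 𝒯, localDet x t f = 0) → f = 0 := by
  classical
  let A : Matrix (𝒯 ⊕ S) V (MvPolynomial (V × Fin d) ℚ) := Matrix.of fun r c =>
    Sum.elim (fun t => localDet (universalConfiguration V d) t.1 (fun u => if c = u then 1 else 0))
      (fun u => if c = u.1 then 1 else 0) r
  have hA : ∀ (z : V → Fin d → ℝ) (f : V → ℝ),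
      A.map (MvPolynomial.aeval (fun w : V × Fin d => z w.1 w.2)) *ᵥ f = 0 ↔
        (∀ u ∈ S, f u = 0) ∧ ∀ t ∈ 𝒯, localDet z t f = 0 := by
    intro z f
    have hinl : ∀ t : 𝒯, (A.map (MvPolynomial.aeval (fun w : V × Fin d => z w.1 w.2)) *ᵥ f)
        (Sum.inl t) = localDet z t.1 f := fun t => by
      rw [LinearMap.pi_apply_eq_sum_univ]
      refine Finset.sum_congr rfl fun c _ => ?_
      rw [smul_eq_mul, mul_comm]
      congr 1
      have := map_localDet (MvPolynomial.aeval (fun w : V × Fin d => z w.1 w.2) :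
        MvPolynomial (V × Fin d) ℚ →ₐ[ℚ] ℝ).toRingHom (universalConfiguration V d) t.1
        (fun u => if c = u then 1 else 0)
      rw [aeval_universalConfiguration] at this
      refine this.trans ?_
      congr 1
      funext u
      split_ifs <;> simp
    have hinr : ∀ u : S, (A.map (MvPolynomial.aeval (fun w : V × Fin d => z w.1 w.2)) *ᵥ f)
        (Sum.inr u) = f u := fun u => by
      simp [A, Matrix.mulVec, dotProduct, apply_ite]
    constructor
    · intro h
      exact ⟨fun u hu => by rw [← hinr ⟨u, hu⟩, h]; rfl, fun t ht => by rw [← hinl ⟨t, ht⟩, h]; rfl⟩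
    · rintro ⟨h1, h2⟩
      funext r
      rcases r with t | u
      · rw [hinl, h2 t.1 t.2]; rfl
      · rw [hinr, h1 u.1 u.2]; rfl
  have : Fintype 𝒯 := Fintype.ofFinite 𝒯
  intro f h1 h2
  exact mulVec_injective_of_algebraicIndependent A hx
    (fun f hf => hy f ((hA y f).1 hf).1 ((hA y f).1 hf).2) f ((hA x f).2 ⟨h1, h2⟩)

/-! ### Affine rigidity of closed neighbourhoods -/

theorem IsVertexConnected.exists_injective_closedNbhd {V : Type*} [Fintype V]
    {G : SimpleGraph V} {k : ℕ} (hG : IsVertexConnected G k) (hcard : k ≤ Fintype.card V)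
    (v : V) : ∃ s : Fin k → V, Function.Injective s ∧ ∀ i, s i ∈ closedNbhd G v := by
  obtain ⟨U, hU, hUv⟩ := hG.exists_subset_closedNbhd hcard v
  let e := (U.equivFinOfCardEq hU).symm
  exact ⟨fun i => (e i).1, Subtype.val_injective.comp e.injective, fun i => hUv _ (e i).2⟩

/-- Points of a generic configuration are in general position, since those of the special
configuration are. The graph serves only to supply the latter. -/
theorem IsVertexConnected.simplexDet_ne_zero {V : Type*} [Fintype V]
    {G : SimpleGraph V} {d : ℕ} (hG : IsVertexConnected G (d + 1))
    {x : V → Fin d → ℝ}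
    (hx : AlgebraicIndependent ℚ (fun z : V × Fin d => x z.1 z.2)) {s : Fin (d + 1) → V}
    (hs : Function.Injective s) : simplexDet x s ≠ 0 := by
  classical
  obtain ⟨W, y, -, -, -, hy⟩ := hG.exists_configuration
    (S := Finset.univ.image s) (by simp [Finset.card_image_of_injective _ hs])
  exact simplexDet_ne_zero_of_algebraicIndependent hx (hy s hs)

/-- A generic configuration of a `(d + 1)`-connected graph is affinely rigid with respect to its
closed neighbourhoods: a function on the vertices all of whose local determinants vanish, that is,
a function which is affine in the positions on each closed neighbourhood, is globally affine. -/
theorem IsVertexConnected.exists_affine {V : Type*} [Fintype V] {G : SimpleGraph V} {d : ℕ}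
    (hG : IsVertexConnected G (d + 1)) (hcard : d + 1 ≤ Fintype.card V) {x : V → Fin d → ℝ}
    (hx : AlgebraicIndependent ℚ (fun z : V × Fin d => x z.1 z.2)) {f : V → ℝ}
    (hf : ∀ t : Option (Fin (d + 1)) → V, (∃ v, ∀ i, t i ∈ closedNbhd G v) →
      localDet x t f = 0) :
    ∃ a : Fin (d + 1) → ℝ, ∀ u, f u = ∑ j, homogeneousCoord x u j * a j := by
  obtain ⟨S, -, hS⟩ := Finset.exists_subset_card_eq (s := (Finset.univ : Finset V)) hcard
  obtain ⟨W, y, hsupp, hker, hinj, hgen⟩ := hG.exists_configuration hS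
  have hrigid := eq_zero_of_localDet_of_algebraicIndependent (y := y) hx S
    {t | ∃ v, ∀ i, t i ∈ closedNbhd G v} (fun g hgS hg => by
      refine hinj g hgS fun v hv => ?_
      obtain ⟨s, hs, hsv⟩ := hG.exists_injective_closedNbhd hcard v
      obtain ⟨a, ha⟩ := exists_affine_of_localDet_eq_zero (hgen s hs) (T := closedNbhd G v)
        (f := g) (fun u hu => hg _ ⟨v, fun i => by cases i <;> simp [hu, hsv]⟩)
      -- On the support of row `v`, the function `g` is affine, so it is annihilated by that row.
      have hrow : ∀ c, W v c * g c = W v c * ∑ j, homogeneousCoord y c j * a j := fun c => by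
        by_cases hc : c ∈ closedNbhd G v
        · rw [ha c hc]
        · rw [hsupp v c hc, zero_mul, zero_mul]
      simp_rw [hrow, Finset.mul_sum, ← mul_assoc]
      rw [Finset.sum_comm]
      exact Finset.sum_eq_zero fun j _ => by rw [← Finset.sum_mul, hker v hv j, zero_mul])
  let e := (S.equivFinOfCardEq hS).symm
  have he : Function.Injective fun i => (e i).1 := Subtype.val_injective.comp e.injective
  obtain ⟨a, ha⟩ := exists_interpolation (hG.simplexDet_ne_zero hx he) f
  refine ⟨a, fun u => ?_⟩
  have h0 : f - (fun u => ∑ j, homogeneousCoord x u j * a j) = 0 := by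
    refine hrigid _ (fun u hu => ?_) fun t ht => ?_
    · obtain ⟨i, hi⟩ := e.surjective ⟨u, hu⟩
      have := ha i
      rw [hi] at this
      exact sub_eq_zero.2 this
    · rw [map_sub, hf t ht, localDet_homogeneousCoord_sum, sub_zero]
  exact sub_eq_zero.1 (congrFun h0 u)

/-! ### Congruence of configurations -/

/-- The norm of a combination with weights of sum zero depends only on the mutual distances. -/
theorem norm_sum_smul_eq_of_dist_eq {ι E : Type*} [Fintype ι] [NormedAddCommGroup E]
    [InnerProductSpace ℝ E] {p q : ι → E} (hpq : ∀ i j, dist (p i) (p j) = dist (q i) (q j))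
    {c : ι → ℝ} (hc : ∑ i, c i = 0) : ‖∑ i, c i • p i‖ = ‖∑ i, c i • q i‖ := by
  rw [← sq_eq_sq₀ (norm_nonneg _) (norm_nonneg _), ← real_inner_self_eq_norm_sq,
    ← real_inner_self_eq_norm_sq, inner_sum_smul_sum_smul_of_sum_eq_zero p hc p hc,
    inner_sum_smul_sum_smul_of_sum_eq_zero q hc q hc]
  simp_rw [← dist_eq_norm, hpq]

/-- Two configurations with the same mutual distances are congruent. -/
theorem euclideanCongruent_of_dist_eq {V : Type*} [Fintype V] [Nonempty V] {d : ℕ}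
    {p q : Configuration V d} (hpq : ∀ u v, dist (p u) (p v) = dist (q u) (q v)) :
    EuclideanCongruent p q := by
  obtain ⟨o⟩ := ‹Nonempty V›
  -- Combinations of displacements from `o` determine a linear isometry between spans.
  let T : Configuration V d → (V → ℝ) →ₗ[ℝ] EuclideanSpace ℝ (Fin d) := fun r =>
    Fintype.linearCombination ℝ (fun u => r u - r o)
  have hT : ∀ (r : Configuration V d) (c : V → ℝ), T r c = ∑ u, c u • (r u - r o) := fun r c =>
    Fintype.linearCombination_apply ℝ _ _
  have hnorm : ∀ c, ‖T p c‖ = ‖T q c‖ := fun c => by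
    classical
    let c' : V → ℝ := c - Pi.single o (∑ u, c u)
    have hc' : ∑ u, c' u = 0 := by simp [c']
    have h : ∀ r : Configuration V d, T r c = ∑ u, c' u • r u := fun r => by
      rw [hT]
      simp [c', smul_sub, sub_smul, Finset.sum_smul, Pi.single_apply]
    rw [h, h]
    exact norm_sum_smul_eq_of_dist_eq hpq hc'
  have hker : LinearMap.ker (T p) ≤ LinearMap.ker (T q) := fun c hc => by
    rw [LinearMap.mem_ker, ← norm_eq_zero, ← hnorm, norm_eq_zero]
    exact hc
  let L₀ : LinearMap.range (T p) →ₗ[ℝ] EuclideanSpace ℝ (Fin d) :=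
    (LinearMap.ker (T p)).liftQ (T q) hker ∘ₗ (T p).quotKerEquivRange.symm.toLinearMap
  have hL₀ : ∀ c, L₀ ⟨T p c, c, rfl⟩ = T q c := fun c => by
    have h : (T p).quotKerEquivRange.symm ⟨T p c, c, rfl⟩ = Submodule.Quotient.mk c := by
      rw [LinearEquiv.symm_apply_eq]
      rfl
    simp [L₀, h]
  let L₁ : LinearMap.range (T p) →ₗᵢ[ℝ] EuclideanSpace ℝ (Fin d) :=
    { L₀ with
      norm_map' := by
        rintro ⟨_, c, rfl⟩
        exact (congrArg norm (hL₀ c)).trans (hnorm c).symm }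
  let L : EuclideanSpace ℝ (Fin d) ≃ₗᵢ[ℝ] EuclideanSpace ℝ (Fin d) :=
    L₁.extend.toLinearIsometryEquiv rfl
  have hL : ∀ u, L (p u - p o) = q u - q o := fun u => by
    classical
    have hTu : ∀ r : Configuration V d, T r (Pi.single u 1) = r u - r o := fun r => by
      simp [T]
    rw [← hTu p, ← hTu q, ← hL₀]
    exact L₁.extend_apply ⟨T p (Pi.single u 1), _, rfl⟩
  refine ⟨((IsometryEquiv.subRight (p o)).trans L.toIsometryEquiv).trans
    (IsometryEquiv.addRight (q o)), fun u => ?_⟩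
  simp [hL]

/-! ### Universal rigidity of the squared graph -/

theorem EuclideanEquivalent.dist_eq {V : Type*} {G : SimpleGraph V} {d : ℕ}
    {p q : Configuration V d} (h : EuclideanEquivalent (squaredGraph G) p q) {v a b : V}
    (ha : a ∈ closedNbhd G v) (hb : b ∈ closedNbhd G v) :
    dist (p a) (p b) = dist (q a) (q b) := by
  by_cases hab : a = b
  · simp [hab]
  · obtain ⟨g, h1, h2⟩ := h a b (squaredGraph_adj_of_mem_closedNbhd ha hb hab)
    rw [← h1, ← h2, g.dist_eq]

/-- The weights `c` combine the included positions to zero as soon as they combine the homogeneous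
coordinates to zero. -/
theorem sum_smul_includeConfiguration_eq_zero {V ι : Type*} [Fintype ι] {d : ℕ} (d' : ℕ)
    {p : Configuration V d} {t : ι → V} {c : ι → ℝ}
    (hc : ∀ j, ∑ i, c i * homogeneousCoord (fun v i => p v i) (t i) j = 0) :
    ∑ i, c i • includeConfiguration d' p (t i) = 0 := by
  ext k
  by_cases hk : (k : ℕ) < d
  · have := hc (Fin.succ ⟨k, hk⟩)
    simp only [homogeneousCoord_succ] at this
    simpa [includeConfiguration, hk] using this
  · simp [includeConfiguration, hk]

/-- If `q` has the same mutual distances as `p` on `d + 2` vertices, then each affine dependency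
among the positions `p` is also one among the positions `q`, so that the local determinants of the
coordinates of `q` vanish. -/
theorem localDet_eq_zero_of_dist_eq {V : Type*} {d d' : ℕ} {p : Configuration V d}
    {q : Configuration V d'} {t : Option (Fin (d + 1)) → V}
    (h : ∀ i j, dist (includeConfiguration d' p (t i)) (includeConfiguration d' p (t j)) =
      dist (q (t i)) (q (t j))) (k : Fin d') :
    localDet (fun v i => p v i) t (fun v => q v k) = 0 := by
  -- `d + 2` vectors of homogeneous coordinates are dependent: pad them with a zero column.
  let M : Matrix (Option (Fin (d + 1))) (Option (Fin (d + 1))) ℝ :=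
    Matrix.of fun i j => Option.elim j 0 (homogeneousCoord (fun v i => p v i) (t i))
  obtain ⟨c, hc0, hc⟩ := Matrix.exists_vecMul_eq_zero_iff.2
    (Matrix.det_eq_zero_of_column_eq_zero (A := M) none fun i => rfl)
  have hcj : ∀ j, ∑ i, c i * homogeneousCoord (fun v i => p v i) (t i) j = 0 := fun j =>
    congrFun hc (some j)
  have hsum : ∑ i, c i = 0 := by simpa using hcj 0
  have hq : ∑ i, c i • q (t i) = 0 := by
    rw [← norm_eq_zero, ← norm_sum_smul_eq_of_dist_eq h hsum,
      sum_smul_includeConfiguration_eq_zero d' hcj, norm_zero]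
  rw [localDet_eq_det, ← Matrix.exists_vecMul_eq_zero_iff]
  refine ⟨c, hc0, funext fun j => ?_⟩
  cases j with
  | none => simpa [Matrix.vecMul, dotProduct] using congrArg (fun z => z k) hq
  | some j => exact hcj j

end GraphFramework

theorem mainTheorem2 {V : Type*} [Fintype V] (G : SimpleGraph V) (d : ℕ)
    (hcard : d + 1 ≤ Fintype.card V)
    (hconn : GraphFramework.IsVertexConnected G (d + 1))
    (p : GraphFramework.Configuration V d) (hp : GraphFramework.IsGeneric p) :
    GraphFramework.IsUniversallyRigid (GraphFramework.squaredGraph G) p := by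
  open GraphFramework in
  intro d' _ q hq
  have : Nonempty V := Fintype.card_pos_iff.1 (by omega)
  obtain ⟨v₀⟩ := this
  have : Nonempty V := ⟨v₀⟩
  let x : V → Fin d → ℝ := fun v i => p v i
  have hx : AlgebraicIndependent ℚ (fun z : V × Fin d => x z.1 z.2) := hp
  choose a ha using fun k : Fin d' => hconn.exists_affine hcard hx (f := fun v => q v k)
    (fun t ⟨v, hv⟩ => localDet_eq_zero_of_dist_eq (fun i j => hq.dist_eq (hv i) (hv j)) k)
  -- Hence affine dependencies between the positions `p` are also dependencies between those of `q`.
  have hdep : ∀ {ι : Type} [Fintype ι] (c : ι → ℝ) (t : ι → V),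
      (∀ j, ∑ i, c i * homogeneousCoord x (t i) j = 0) → ∑ i, c i • q (t i) = 0 := by
    intro ι _ c t hc
    ext k
    have h : ∑ i, c i * q (t i) k = 0 := by
      simp_rw [ha k, Finset.mul_sum, ← mul_assoc]
      rw [Finset.sum_comm]
      exact Finset.sum_eq_zero fun j _ => by rw [← Finset.sum_mul, hc j, zero_mul]
    simpa using h
  obtain ⟨s, hs, hsv⟩ := hconn.exists_injective_closedNbhd hcard v₀
  have hdet := hconn.simplexDet_ne_zero hx hs
  refine euclideanCongruent_of_dist_eq fun u v => ?_
  -- The displacement between `u` and `v` is a combination of the points `s i`, whose mutual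
  -- distances are preserved.
  obtain ⟨c, hc⟩ := exists_barycentric hdet (homogeneousCoord x u - homogeneousCoord x v)
  have hsum : ∑ i, c i = 0 := by simpa using (hc 0).symm
  let b : Option (Option (Fin (d + 1))) → ℝ := fun i => i.elim 1 fun i => i.elim (-1) fun i => -c i
  let t : Option (Option (Fin (d + 1))) → V := fun i => i.elim u fun i => i.elim v s
  have hb : ∀ j, ∑ i, b i * homogeneousCoord x (t i) j = 0 := fun j => by
    have := hc j
    simp only [Pi.sub_apply] at this
    simp only [b, t, Fintype.sum_option, Option.elim, neg_mul, Finset.sum_neg_distrib, ← this]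
    ring
  have hp0 := sum_smul_includeConfiguration_eq_zero d' hb
  have hq0 := hdep b t hb
  have hdisp : ∀ r : Configuration V d', ∑ i, b i • r (t i) = 0 →
      r u - r v = ∑ i, c i • r (s i) := fun r hr => by
    simp only [b, t, Fintype.sum_option, Option.elim, neg_smul, Finset.sum_neg_distrib,
      one_smul] at hr
    rw [← sub_eq_zero, ← hr]
    abel
  rw [dist_eq_norm, dist_eq_norm, hdisp _ hp0, hdisp q hq0]
  exact norm_sum_smul_eq_of_dist_eq (fun i j => hq.dist_eq (hsv i) (hsv j)) hsum
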